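/- Write $M_d$ for the complex $d\times d$ matrices and $M_d^+$ for the positive semidefinite ones, and identify $M_k\otimes M_d$ with $M_k(M_d)$. A matrix $X\in(M_m\otimes M_n)^+$ is separable if $X=\sum_{i=1}^N A_i\otimes B_i$ with $A_i\in M_m^+$, $B_i\in M_n^+$. The Schmidt rank $SR(\xi)$ of $\xi\in\mathbb{C}^m\otimes\mathbb{C}^n$ is the number of non-zero coefficients in a Schmidt decomposition $\xi=\sum_i\lambda_i\,u_i\otimes v_i$ ($\lambda_i\ge 0$, $\{u_i\}$ and $\{v_i\}$ orthonormal), so that $SR(0)=0$. The Schmidt number of $X\in(M_m\otimes M_n)^+$ is $$SN(X)=\min\Big\{\max_{1\le i\le N} SR(\xi_i) : X=\sum_{i=1}^N |\xi_i\rangle\langle\xi_i|,\ N\ge 1\Big\}.$$ Let $\Phi:M_{a}\to M_{b}$ be linear. It is $k$-positive if $\mathrm{id}_k\otimes\Phi$ maps $(M_k\otimes M_a)^+$ into $(M_k\otimes M_b)^+$, and completely positive (CP) if it is $k$-positive for all $k\ge1$. It is $k$-entanglement breaking if it is $k$-positive and $(\mathrm{id}_k\otimes\Phi)(X)$ is separable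 for every $X\in(M_k\otimes M_a)^+$. It is entanglement breaking (EB) if $(\mathrm{id}_k\otimes\Phi)(X)$ is separable for all $k\ge 1$ and all $X\in(M_k\otimes M_a)^+$. It is $k$-partially entanglement breaking ($k$-PEB) if it is CP and $\Phi(X)=\sum_{i=1}^N V_i^*XV_i$ for some $V_i\in M_{a\times b}$ of rank at most $k$. If $\Phi$ is CP, its Schmidt number is $SN(\Phi):=SN(C_\Phi)$, where $C_\Phi=[\Phi(E_{ij})]_{i,j}\in M_a\otimes M_b$ is its Choi matrix. **Theorem.** Let $d_1,d_2>1$ and let $\Phi:M_{d_1}\to M_{d_2}$ be a CP map. The following are equivalent: 1. $\Phi$ is $2$-entanglement breaking; 2. $SN(\Phi\circ\Psi)<SN(\Psi)$ for every $m$ with $2\le m\le d_2$ and every CP map $\Psi:M_m\to M_{d_1}$ that is not EB; 3. $SN(\Phi\circ\Psi)<SN(\Psi)$ for every $m\ge 2$ and every $d_2$-PEB map $\Psi:M_m\to M_{d_1}$ that is not EB; 4. $SN(\Phi\circ\Psi)<SN(\Psi)$ for every CP map $\Psi:M_2\to M_{d_1}$ that is not EB. -/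

import Mathlib

open scoped Matrix Kronecker ComplexOrder

namespace EntBreak

/-- The action of `id ⊗ Φ : M_k ⊗ M_{d₁} → M_k ⊗ M_{d₂}` under the identification
`M_k ⊗ M_d = M_k(M_d)`: `Φ` is applied to every block `[X_{ij}]`. -/
def ampliation {d₁ d₂ : ℕ} (k : ℕ)
    (Φ : Matrix (Fin d₁) (Fin d₁) ℂ →ₗ[ℂ] Matrix (Fin d₂) (Fin d₂) ℂ)
    (X : Matrix (Fin k × Fin d₁) (Fin k × Fin d₁) ℂ) :
    Matrix (Fin k × Fin d₂) (Fin k × Fin d₂) ℂ :=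
  Matrix.of fun p q => Φ (Matrix.of fun a b => X (p.1, a) (q.1, b)) p.2 q.2

/-- `Φ` is `k`-positive: `id_k ⊗ Φ` maps positive semidefinite matrices to such matrices. -/
def IsKPositive {d₁ d₂ : ℕ} (k : ℕ)
    (Φ : Matrix (Fin d₁) (Fin d₁) ℂ →ₗ[ℂ] Matrix (Fin d₂) (Fin d₂) ℂ) : Prop :=
  ∀ X : Matrix (Fin k × Fin d₁) (Fin k × Fin d₁) ℂ, X.PosSemidef →
    (ampliation k Φ X).PosSemidef

/-- `Φ` is completely positive: `k`-positive for every `k ≥ 1`. -/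
def IsCP {d₁ d₂ : ℕ}
    (Φ : Matrix (Fin d₁) (Fin d₁) ℂ →ₗ[ℂ] Matrix (Fin d₂) (Fin d₂) ℂ) : Prop :=
  ∀ k : ℕ, 1 ≤ k → IsKPositive k Φ

/-- `X` is separable: a finite sum of Kronecker products of positive semidefinite matrices. -/
def IsSeparable {m n : ℕ} (X : Matrix (Fin m × Fin n) (Fin m × Fin n) ℂ) : Prop :=
  ∃ (N : ℕ) (A : Fin N → Matrix (Fin m) (Fin m) ℂ) (B : Fin N → Matrix (Fin n) (Fin n) ℂ),
    (∀ i, (A i).PosSemidef) ∧ (∀ i, (B i).PosSemidef) ∧ X = ∑ i, A i ⊗ₖ B i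

/-- `Φ` is `k`-entanglement breaking. -/
def IsKEB {d₁ d₂ : ℕ} (k : ℕ)
    (Φ : Matrix (Fin d₁) (Fin d₁) ℂ →ₗ[ℂ] Matrix (Fin d₂) (Fin d₂) ℂ) : Prop :=
  IsKPositive k Φ ∧
    ∀ X : Matrix (Fin k × Fin d₁) (Fin k × Fin d₁) ℂ, X.PosSemidef →
      IsSeparable (ampliation k Φ X)

/-- `Φ` is entanglement breaking. -/
def IsEB {d₁ d₂ : ℕ}
    (Φ : Matrix (Fin d₁) (Fin d₁) ℂ →ₗ[ℂ] Matrix (Fin d₂) (Fin d₂) ℂ) : Prop :=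
  ∀ k : ℕ, 1 ≤ k → ∀ X : Matrix (Fin k × Fin d₁) (Fin k × Fin d₁) ℂ, X.PosSemidef →
    IsSeparable (ampliation k Φ X)

/-- `Φ` is `k`-partially entanglement breaking: `Φ = ∑ Ad_{V_i}` with `Ad_V X = V* X V` and every
`V_i` of rank at most `k`. -/
def IsKPEB {d₁ d₂ : ℕ} (k : ℕ)
    (Φ : Matrix (Fin d₁) (Fin d₁) ℂ →ₗ[ℂ] Matrix (Fin d₂) (Fin d₂) ℂ) : Prop :=
  IsCP Φ ∧ ∃ (N : ℕ) (V : Fin N → Matrix (Fin d₁) (Fin d₂) ℂ),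
    (∀ i, (V i).rank ≤ k) ∧ ∀ X, Φ X = ∑ i, (V i)ᴴ * X * V i

/-- `ξ ∈ ℂ^m ⊗ ℂ^n` has a Schmidt decomposition `ξ = ∑ c_i (u_i ⊗ v_i)` with exactly `r` non-zero
coefficients (only the terms with non-zero coefficient are listed). -/
def HasSchmidtDecomposition {m n : ℕ} (ξ : Fin m × Fin n → ℂ) (r : ℕ) : Prop :=
  ∃ (u : Fin r → EuclideanSpace ℂ (Fin m)) (v : Fin r → EuclideanSpace ℂ (Fin n))
    (c : Fin r → ℝ), Orthonormal ℂ u ∧ Orthonormal ℂ v ∧ (∀ i, 0 < c i) ∧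
      ∀ a b, ξ (a, b) = ∑ i, (c i : ℂ) * (u i a * v i b)

/-- The Schmidt rank of a vector: the number of non-zero coefficients in a Schmidt decomposition.
It exists and is unique by `hasSchmidtDecomposition_iff` below. -/
noncomputable def schmidtRank {m n : ℕ} (ξ : Fin m × Fin n → ℂ) : ℕ :=
  sInf {r | HasSchmidtDecomposition ξ r}

/-- The Schmidt number of a positive semidefinite `X`: the minimum, over all decompositions
`X = ∑ ξ_i ξ_i*`, of the largest Schmidt rank of the `ξ_i`. -/
noncomputable def schmidtNumber {m n : ℕ}
    (X : Matrix (Fin m × Fin n) (Fin m × Fin n) ℂ) : ℕ :=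
  sInf {s | ∃ (N : ℕ) (ξ : Fin N → Fin m × Fin n → ℂ), 1 ≤ N ∧
    X = ∑ i, Matrix.vecMulVec (ξ i) (star (ξ i)) ∧
    s = Finset.univ.sup fun i => schmidtRank (ξ i)}

/-- The Choi matrix `C_Φ = [Φ(E_{ij})]`. -/
def choi {d₁ d₂ : ℕ}
    (Φ : Matrix (Fin d₁) (Fin d₁) ℂ →ₗ[ℂ] Matrix (Fin d₂) (Fin d₂) ℂ) :
    Matrix (Fin d₁ × Fin d₂) (Fin d₁ × Fin d₂) ℂ :=
  Matrix.of fun p q => Φ (Matrix.single p.1 q.1 1) p.2 q.2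

/-- The Schmidt number of a completely positive map. -/
noncomputable def SN {d₁ d₂ : ℕ}
    (Φ : Matrix (Fin d₁) (Fin d₁) ℂ →ₗ[ℂ] Matrix (Fin d₂) (Fin d₂) ℂ) : ℕ :=
  schmidtNumber (choi Φ)

theorem HasSchmidtDecomposition.eq_rank {m n : ℕ} {ξ : Fin m × Fin n → ℂ} {r : ℕ}
    (h : HasSchmidtDecomposition ξ r) : r = (Matrix.of fun a b => ξ (a, b)).rank := by
  obtain ⟨u, v, c, hu, hv, hc, hξ⟩ := h
  set M : Matrix (Fin m) (Fin n) ℂ := Matrix.of fun a b => ξ (a, b) with hM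
  let U : Matrix (Fin m) (Fin r) ℂ := Matrix.of fun a i => u i a
  let V : Matrix (Fin n) (Fin r) ℂ := Matrix.of fun b i => v i b
  let D : Matrix (Fin r) (Fin r) ℂ := Matrix.diagonal fun i => (c i : ℂ)
  have hU : Uᴴ * U = 1 := by
    ext i j
    have := (orthonormal_iff_ite.1 hu) i j
    simp only [PiLp.inner_apply, RCLike.inner_apply] at this
    rw [Matrix.mul_apply, Matrix.one_apply, ← this]
    exact Finset.sum_congr rfl fun a _ => by simp [U, mul_comm]
  have hV : Vᴴ * V = 1 := by
    ext i j
    have := (orthonormal_iff_ite.1 hv) i j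
    simp only [PiLp.inner_apply, RCLike.inner_apply] at this
    rw [Matrix.mul_apply, Matrix.one_apply, ← this]
    exact Finset.sum_congr rfl fun a _ => by simp [V, mul_comm]
  have hV' : Vᵀ * Vᴴᵀ = 1 := by
    rw [← Matrix.transpose_mul, hV, Matrix.transpose_one]
  have hMD : M = U * D * Vᵀ := by
    ext a b
    rw [Matrix.mul_apply]
    simp only [hM, Matrix.of_apply, hξ, D, Matrix.mul_diagonal, Matrix.transpose_apply, U, V]
    exact Finset.sum_congr rfl fun i _ => by ring
  have hDM : D = Uᴴ * M * Vᴴᵀ := by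
    rw [hMD]
    calc D = (Uᴴ * U) * D * (Vᵀ * Vᴴᵀ) := by rw [hU, hV', one_mul, mul_one]
      _ = _ := by simp only [Matrix.mul_assoc]
  have hD : D.rank = r := by
    rw [Matrix.rank_of_isUnit, Fintype.card_fin]
    rw [Matrix.isUnit_iff_isUnit_det, Matrix.det_diagonal, isUnit_iff_ne_zero]
    exact Finset.prod_ne_zero_iff.2 fun i _ => by exact_mod_cast (hc i).ne'
  apply le_antisymm
  · rw [← hD, hDM]
    exact (Matrix.rank_mul_le_left _ _).trans (Matrix.rank_mul_le_right _ _)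
  · rw [← hD, hMD]
    exact (Matrix.rank_mul_le_left _ _).trans (Matrix.rank_mul_le_right _ _)

theorem exists_hasSchmidtDecomposition {m n : ℕ} (ξ : Fin m × Fin n → ℂ) :
    ∃ r, HasSchmidtDecomposition ξ r := by
  set M : Matrix (Fin m) (Fin n) ℂ := Matrix.of fun a b => ξ (a, b) with hM
  have hP : (M * Mᴴ).PosSemidef := Matrix.posSemidef_self_mul_conjTranspose M
  let E := hP.1.eigenvectorBasis
  let l := hP.1.eigenvalues
  have hl : ∀ i, 0 ≤ l i := hP.eigenvalues_nonneg
  let w : Fin m → EuclideanSpace ℂ (Fin n) := fun i =>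
    WithLp.toLp 2 (star (E i : Fin m → ℂ) ᵥ* M)
  have hw : ∀ i j, inner ℂ (w i) (w j) = if i = j then (l i : ℂ) else 0 := by
    intro i j
    have h1 : inner ℂ (w i) (w j) = star (E j : Fin m → ℂ) ⬝ᵥ ((M * Mᴴ) *ᵥ (E i : Fin m → ℂ)) := by
      rw [EuclideanSpace.inner_eq_star_dotProduct]
      simp only [w]
      rw [Matrix.star_vecMul, star_star, ← Matrix.mulVec_mulVec, Matrix.dotProduct_mulVec,
        Matrix.dotProduct_mulVec, Matrix.dotProduct_mulVec]
    have h2 := hP.1.mulVec_eigenvectorBasis i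
    have h3 : inner ℂ (E i) (E j) = if i = j then (1 : ℂ) else 0 :=
      orthonormal_iff_ite.1 E.orthonormal i j
    have h4 : star (E j : Fin m → ℂ) ⬝ᵥ (E i : Fin m → ℂ) = if i = j then (1 : ℂ) else 0 := by
      have := orthonormal_iff_ite.1 E.orthonormal j i
      rw [EuclideanSpace.inner_eq_star_dotProduct, dotProduct_comm] at this
      rw [this]
      simp only [eq_comm]
    rw [h1, h2, dotProduct_smul, h4]
    split_ifs <;> simp [l]
  have hw0 : ∀ i, l i = 0 → w i = 0 := by
    intro i hi
    have := hw i i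
    rw [if_pos rfl, hi, Complex.ofReal_zero] at this
    exact inner_self_eq_zero.1 this
  have hsum : ∀ a b, ξ (a, b) = ∑ i, E i a * w i b := by
    intro a b
    have h1 : ∀ a a', ∑ i, E i a * star (E i a') = if a = a' then (1 : ℂ) else 0 := by
      intro a a'
      have h := E.sum_inner_mul_inner (EuclideanSpace.single a (1 : ℂ))
        (EuclideanSpace.single a' (1 : ℂ))
      simp only [EuclideanSpace.inner_single_left, EuclideanSpace.inner_single_right] at h
      simpa [Pi.single_apply, eq_comm] using h
    have h2 : ∀ i, w i b = ∑ a', star (E i a') * M a' b := by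
      intro i
      simp [w, Matrix.vecMul, dotProduct]
    simp only [h2, Finset.mul_sum]
    rw [Finset.sum_comm]
    simp only [← mul_assoc, ← Finset.sum_mul, h1]
    simp [hM]
  let S := {i // l i ≠ 0}
  let e : Fin (Fintype.card S) ≃ S := (Fintype.equivFin S).symm
  have hpos : ∀ i : S, 0 < l i.1 := fun i => lt_of_le_of_ne (hl i.1) (Ne.symm i.2)
  refine ⟨Fintype.card S, fun i => E (e i).1,
    fun i => ((Real.sqrt (l (e i).1) : ℂ))⁻¹ • w (e i).1,
    fun i => Real.sqrt (l (e i).1), ?_, ?_, fun i => Real.sqrt_pos.2 (hpos _), ?_⟩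
  · exact E.orthonormal.comp _ (Subtype.val_injective.comp e.injective)
  · rw [orthonormal_iff_ite]
    intro i j
    rw [inner_smul_left, inner_smul_right, hw]
    have hij : ((e i).1 = (e j).1) ↔ i = j := by
      rw [Subtype.val_inj, e.apply_eq_iff_eq]
    by_cases h : i = j
    · subst h
      have h0 : (Real.sqrt (l (e i).1) : ℂ) ≠ 0 := by
        exact_mod_cast (Real.sqrt_pos.2 (hpos (e i))).ne'
      have h1 : (l (e i).1 : ℂ) = Real.sqrt (l (e i).1) * Real.sqrt (l (e i).1) := by
        exact_mod_cast (Real.mul_self_sqrt (hl _)).symm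
      simp only [if_true, map_inv₀, Complex.conj_ofReal]
      rw [h1]
      field_simp
    · simp [hij, h]
  · intro a b
    rw [hsum, ← Finset.sum_subset (Finset.subset_univ (Finset.univ.filter fun i => l i ≠ 0))]
    · rw [Finset.sum_subtype (p := fun i => l i ≠ 0) _ (by simp), ← e.sum_comp]
      refine Finset.sum_congr rfl fun i _ => ?_
      have h0 : (Real.sqrt (l (e i).1) : ℂ) ≠ 0 := by
        exact_mod_cast (Real.sqrt_pos.2 (hpos (e i))).ne'
      simp only [PiLp.smul_apply, smul_eq_mul]
      field_simp
    · intro i _ hi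
      have : l i = 0 := by simpa using hi
      simp [hw0 i this]

/-- The Schmidt rank is well defined, and it is the rank of the coefficient matrix. -/
theorem hasSchmidtDecomposition_iff {m n : ℕ} (ξ : Fin m × Fin n → ℂ) (r : ℕ) :
    HasSchmidtDecomposition ξ r ↔ r = (Matrix.of fun a b => ξ (a, b)).rank := by
  refine ⟨fun h => h.eq_rank, fun h => ?_⟩
  obtain ⟨s, hs⟩ := exists_hasSchmidtDecomposition ξ
  rwa [h, ← hs.eq_rank]

theorem schmidtRank_eq_rank {m n : ℕ} (ξ : Fin m × Fin n → ℂ) :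
    schmidtRank ξ = (Matrix.of fun a b => ξ (a, b)).rank := by
  simp [schmidtRank, hasSchmidtDecomposition_iff]

end EntBreak

namespace EntBreak

open Matrix

/-! Through Choi matrices, composition of maps becomes the contraction `link`, and `SN ≤ s` becomes
membership in the cone `schmidtCone` generated by the `outer M` with `M.rank ≤ s`; separable means
`s = 1`. As `link (outer Z) (outer M) = outer (Z * M)`, contraction never raises the Schmidt number.

For 2-entanglement breaking `Φ` it drops by one (`link_mem_schmidtCone_pred`). Given `M` of rank `r
≥ 2`, write `M = U * V` with `V` having `r` rows. Keeping two rows of `V` compresses `Y = link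
(outer V) (choi Φ)` to a separable matrix. A decomposition of the compression lifts to `Y`
(`mem_closure_of_submatrix_mem_schmidtCone`), and restoring the other `r - 2` rows raises the rank
from at most 1 to at most `r - 1`. Multiplying by `U` is harmless.

Conversely, every positive semidefinite `X` in `M_2 ⊗ M_{d₁}` is the Choi matrix of a CP map on
`M_2`, of Schmidt number at most 2, so a strict drop forces `link X (choi Φ)` to be separable. -/

/-- The rank one positive semidefinite matrix `ξ ξ*`, where `ξ` is the vector of entries of `M`. -/
def outer {m n : ℕ} (M : Matrix (Fin m) (Fin n) ℂ) :
    Matrix (Fin m × Fin n) (Fin m × Fin n) ℂ :=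
  vecMulVec (fun p => M p.1 p.2) (star fun p => M p.1 p.2)

/-- The cone of positive semidefinite matrices of Schmidt number at most `s`. -/
def schmidtCone (m n s : ℕ) : AddSubmonoid (Matrix (Fin m × Fin n) (Fin m × Fin n) ℂ) :=
  AddSubmonoid.closure {X | ∃ M : Matrix (Fin m) (Fin n) ℂ, M.rank ≤ s ∧ X = outer M}

/-- Contraction of the middle factor of `X ∈ M_k ⊗ M_m` and `C ∈ M_m ⊗ M_n`. -/
def link {k m n : ℕ} (X : Matrix (Fin k × Fin m) (Fin k × Fin m) ℂ)
    (C : Matrix (Fin m × Fin n) (Fin m × Fin n) ℂ) :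
    Matrix (Fin k × Fin n) (Fin k × Fin n) ℂ :=
  Matrix.of fun p q => ∑ i, ∑ j, X (p.1, i) (q.1, j) * C (i, p.2) (j, q.2)

/-! ### Algebra of the contraction. -/

section link

variable {k m n l : ℕ}

theorem link_add_left (X Y : Matrix (Fin k × Fin m) (Fin k × Fin m) ℂ)
    (C : Matrix (Fin m × Fin n) (Fin m × Fin n) ℂ) :
    link (X + Y) C = link X C + link Y C := by
  ext p q
  simp [link, add_mul, Finset.sum_add_distrib]

theorem link_add_right (X : Matrix (Fin k × Fin m) (Fin k × Fin m) ℂ)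
    (C D : Matrix (Fin m × Fin n) (Fin m × Fin n) ℂ) :
    link X (C + D) = link X C + link X D := by
  ext p q
  simp [link, mul_add, Finset.sum_add_distrib]

theorem link_zero_left (C : Matrix (Fin m × Fin n) (Fin m × Fin n) ℂ) :
    link (0 : Matrix (Fin k × Fin m) (Fin k × Fin m) ℂ) C = 0 := by
  ext p q
  simp [link]

theorem link_zero_right (X : Matrix (Fin k × Fin m) (Fin k × Fin m) ℂ) :
    link X (0 : Matrix (Fin m × Fin n) (Fin m × Fin n) ℂ) = 0 := by
  ext p q
  simp [link]

theorem link_outer_outer (Z : Matrix (Fin k) (Fin m) ℂ) (M : Matrix (Fin m) (Fin n) ℂ) :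
    link (outer Z) (outer M) = outer (Z * M) := by
  ext p q
  simp only [link, outer, of_apply, vecMulVec_apply, Pi.star_apply, mul_apply, star_sum, star_mul',
    Finset.sum_mul_sum]
  exact Finset.sum_congr rfl fun i _ => Finset.sum_congr rfl fun j _ => by ring

/-- Needed to peel the left factor `U` off a factorization `M = U * V` after contracting with a Choi
matrix. -/
theorem link_assoc (X : Matrix (Fin k × Fin m) (Fin k × Fin m) ℂ)
    (Y : Matrix (Fin m × Fin n) (Fin m × Fin n) ℂ)
    (Z : Matrix (Fin n × Fin l) (Fin n × Fin l) ℂ) :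
    link (link X Y) Z = link X (link Y Z) := by
  ext p q
  simp only [link, of_apply, Finset.sum_mul, Finset.mul_sum]
  have h1 : ∀ f : Fin n → Fin n → Fin m → Fin m → ℂ,
      ∑ a, ∑ b, ∑ i, ∑ j, f a b i j = ∑ i, ∑ j, ∑ a, ∑ b, f a b i j := by
    intro f
    simp only [← Finset.sum_product', Finset.univ_product_univ]
    simpa only [Fintype.sum_prod_type] using
      Finset.sum_comm (s := (Finset.univ : Finset (Fin n × Fin n)))
        (t := (Finset.univ : Finset (Fin m × Fin m))) (f := fun x y => f x.1 x.2 y.1 y.2)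
  rw [h1]
  simp only [mul_assoc]

theorem link_submatrix (g : Fin l → Fin k) (X : Matrix (Fin k × Fin m) (Fin k × Fin m) ℂ)
    (C : Matrix (Fin m × Fin n) (Fin m × Fin n) ℂ) :
    (link X C).submatrix (Prod.map g id) (Prod.map g id) =
      link (X.submatrix (Prod.map g id) (Prod.map g id)) C :=
  rfl

theorem outer_submatrix (g : Fin l → Fin k) (M : Matrix (Fin k) (Fin m) ℂ) :
    (outer M).submatrix (Prod.map g id) (Prod.map g id) = outer (M.submatrix g id) :=
  rfl

end link

/-! ### Cones of bounded Schmidt number. -/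

section cone

variable {k m n s t : ℕ}

theorem outer_mem_schmidtCone {M : Matrix (Fin m) (Fin n) ℂ} (h : M.rank ≤ s) :
    outer M ∈ schmidtCone m n s :=
  AddSubmonoid.subset_closure ⟨M, h, rfl⟩

theorem schmidtCone_mono (h : s ≤ t) : schmidtCone m n s ≤ schmidtCone m n t :=
  AddSubmonoid.closure_mono fun _ ⟨M, hM, hX⟩ => ⟨M, hM.trans h, hX⟩

theorem posSemidef_outer (M : Matrix (Fin m) (Fin n) ℂ) : (outer M).PosSemidef :=
  posSemidef_vecMulVec_self_star _

theorem posSemidef_of_mem_schmidtCone {X : Matrix (Fin m × Fin n) (Fin m × Fin n) ℂ}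
    (h : X ∈ schmidtCone m n s) : X.PosSemidef := by
  induction h using AddSubmonoid.closure_induction with
  | mem X hX => obtain ⟨M, -, rfl⟩ := hX; exact posSemidef_outer M
  | zero => exact PosSemidef.zero
  | add X Y _ _ hX hY => exact hX.add hY

open scoped MatrixOrder Matrix.Norms.L2Operator in
theorem exists_eq_mul_conjTranspose {ι : Type*} [Fintype ι] [DecidableEq ι] {X : Matrix ι ι ℂ}
    (h : X.PosSemidef) : ∃ S : Matrix ι ι ℂ, X = S * Sᴴ := by
  obtain ⟨B, hB⟩ := CStarAlgebra.nonneg_iff_eq_star_mul_self.mp h.nonneg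
  exact ⟨Bᴴ, by rw [conjTranspose_conjTranspose, hB, star_eq_conjTranspose]⟩

theorem mul_conjTranspose_eq_sum {ι κ : Type*} [Fintype κ] (S : Matrix ι κ ℂ) :
    S * Sᴴ = ∑ j, vecMulVec (S.col j) (star (S.col j)) := by
  ext p q
  simp [mul_apply, Matrix.sum_apply, vecMulVec_apply]

theorem vecMulVec_eq_outer (ξ : Fin m × Fin n → ℂ) :
    vecMulVec ξ (star ξ) = outer (Matrix.of fun a b => ξ (a, b)) :=
  rfl

theorem mem_schmidtCone_of_posSemidef {X : Matrix (Fin m × Fin n) (Fin m × Fin n) ℂ}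
    (h : X.PosSemidef) (hs : m ≤ s) : X ∈ schmidtCone m n s := by
  obtain ⟨S, rfl⟩ := exists_eq_mul_conjTranspose h
  rw [mul_conjTranspose_eq_sum]
  refine sum_mem fun j _ => ?_
  rw [vecMulVec_eq_outer]
  exact outer_mem_schmidtCone ((rank_le_height _).trans hs)

theorem exists_sum_of_mem_schmidtCone {X : Matrix (Fin m × Fin n) (Fin m × Fin n) ℂ}
    (h : X ∈ schmidtCone m n s) :
    ∃ (N : ℕ) (M : Fin N → Matrix (Fin m) (Fin n) ℂ), (∀ i, (M i).rank ≤ s) ∧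
      X = ∑ i, outer (M i) := by
  induction h using AddSubmonoid.closure_induction with
  | mem X hX =>
    obtain ⟨M, hM, rfl⟩ := hX
    exact ⟨1, fun _ => M, fun _ => hM, by simp⟩
  | zero => exact ⟨0, fun i => i.elim0, fun i => i.elim0, by simp⟩
  | add X Y _ _ hX hY =>
    obtain ⟨N, A, hA, rfl⟩ := hX
    obtain ⟨N', B, hB, rfl⟩ := hY
    refine ⟨N + N', Fin.append A B, fun i => ?_, by simp [Fin.sum_univ_add]⟩
    induction i using Fin.addCases with
    | left i => simpa using hA i
    | right i => simpa using hB i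

/-- `link` is biadditive, so membership need only be checked on generators of the two cones. -/
theorem link_mem_of_outer_mem {X : Matrix (Fin k × Fin m) (Fin k × Fin m) ℂ}
    {C : Matrix (Fin m × Fin n) (Fin m × Fin n) ℂ} {r : ℕ}
    (S : AddSubmonoid (Matrix (Fin k × Fin n) (Fin k × Fin n) ℂ))
    (hX : X ∈ schmidtCone k m s) (hC : C ∈ schmidtCone m n r)
    (h : ∀ (Z : Matrix (Fin k) (Fin m) ℂ) (M : Matrix (Fin m) (Fin n) ℂ), Z.rank ≤ s →
      M.rank ≤ r → outer (Z * M) ∈ S) : link X C ∈ S := by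
  induction hX using AddSubmonoid.closure_induction with
  | mem X hX =>
    obtain ⟨Z, hZ, rfl⟩ := hX
    induction hC using AddSubmonoid.closure_induction with
    | mem C hC =>
      obtain ⟨M, hM, rfl⟩ := hC
      rw [link_outer_outer]
      exact h Z M hZ hM
    | zero => rw [link_zero_right]; exact zero_mem _
    | add C D _ _ hC hD => rw [link_add_right]; exact add_mem hC hD
  | zero => rw [link_zero_left]; exact zero_mem _
  | add X Y _ _ hX hY => rw [link_add_left]; exact add_mem hX hY

theorem link_mem_schmidtCone_left {X : Matrix (Fin k × Fin m) (Fin k × Fin m) ℂ}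
    {C : Matrix (Fin m × Fin n) (Fin m × Fin n) ℂ}
    (hX : X ∈ schmidtCone k m s) (hC : C.PosSemidef) : link X C ∈ schmidtCone k n s :=
  link_mem_of_outer_mem _ hX (mem_schmidtCone_of_posSemidef hC le_rfl) fun Z M hZ _ =>
    outer_mem_schmidtCone ((rank_mul_le_left Z M).trans hZ)

theorem link_mem_schmidtCone_right {X : Matrix (Fin k × Fin m) (Fin k × Fin m) ℂ}
    {C : Matrix (Fin m × Fin n) (Fin m × Fin n) ℂ}
    (hX : X.PosSemidef) (hC : C ∈ schmidtCone m n s) : link X C ∈ schmidtCone k n s :=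
  link_mem_of_outer_mem _ (mem_schmidtCone_of_posSemidef hX le_rfl) hC fun Z M _ hM =>
    outer_mem_schmidtCone ((rank_mul_le_right Z M).trans hM)

theorem link_posSemidef {X : Matrix (Fin k × Fin m) (Fin k × Fin m) ℂ}
    {C : Matrix (Fin m × Fin n) (Fin m × Fin n) ℂ}
    (hX : X.PosSemidef) (hC : C.PosSemidef) : (link X C).PosSemidef :=
  posSemidef_of_mem_schmidtCone
    (link_mem_schmidtCone_left (mem_schmidtCone_of_posSemidef hX le_rfl) hC)

end cone

/-! ### Schmidt number and separability in terms of the cones. -/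

section schmidtNumber

variable {m n s : ℕ}

theorem schmidtNumber_le_of_mem {X : Matrix (Fin m × Fin n) (Fin m × Fin n) ℂ}
    (h : X ∈ schmidtCone m n s) : schmidtNumber X ≤ s := by
  obtain ⟨N, M, hM, rfl⟩ := exists_sum_of_mem_schmidtCone h
  -- A zero vector is prepended because the definition demands `1 ≤ N`, while the sum may be empty.
  refine le_trans (Nat.sInf_le (m := Finset.univ.sup fun i => schmidtRank
    ((Fin.cons 0 fun i p => M i p.1 p.2 : Fin (N + 1) → Fin m × Fin n → ℂ) i))
    ⟨N + 1, Fin.cons 0 fun i p => M i p.1 p.2, Nat.le_add_left _ _, ?_, rfl⟩)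
    (Finset.sup_le fun i _ => ?_)
  · simp [Fin.sum_univ_succ, outer]
  · rw [schmidtRank_eq_rank]
    induction i using Fin.cases with
    | zero =>
      have : (Matrix.of fun (_ : Fin m) (_ : Fin n) => (0 : ℂ)) = 0 := rfl
      simp [this]
    | succ i => exact hM i

theorem mem_schmidtCone_schmidtNumber {X : Matrix (Fin m × Fin n) (Fin m × Fin n) ℂ}
    (h : X.PosSemidef) : X ∈ schmidtCone m n (schmidtNumber X) := by
  obtain ⟨N, M, -, hX⟩ := exists_sum_of_mem_schmidtCone (mem_schmidtCone_of_posSemidef h le_rfl)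
  -- The infimum is attained only once some decomposition exists: `sInf ∅` would be 0 in `ℕ`.
  obtain ⟨N', ξ, -, hX', hs⟩ := Nat.sInf_mem (s := {s | ∃ (N : ℕ) (ξ : Fin N → Fin m × Fin n → ℂ),
      1 ≤ N ∧ X = ∑ i, Matrix.vecMulVec (ξ i) (star (ξ i)) ∧
      s = Finset.univ.sup fun i => schmidtRank (ξ i)})
    ⟨_, N + 1, Fin.cons 0 fun i p => M i p.1 p.2, Nat.le_add_left _ _,
      by rw [hX]; simp [Fin.sum_univ_succ, outer], rfl⟩
  rw [schmidtNumber, hs]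
  nth_rewrite 1 [hX']
  refine sum_mem fun i _ => ?_
  rw [vecMulVec_eq_outer]
  refine outer_mem_schmidtCone ?_
  rw [← schmidtRank_eq_rank]
  exact Finset.le_sup (f := fun i => schmidtRank (ξ i)) (Finset.mem_univ i)

theorem schmidtNumber_le_iff {X : Matrix (Fin m × Fin n) (Fin m × Fin n) ℂ}
    (h : X.PosSemidef) : schmidtNumber X ≤ s ↔ X ∈ schmidtCone m n s :=
  ⟨fun hs => schmidtCone_mono hs (mem_schmidtCone_schmidtNumber h), schmidtNumber_le_of_mem⟩

theorem exists_eq_mul_rank (M : Matrix (Fin m) (Fin n) ℂ) :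
    ∃ (U : Matrix (Fin m) (Fin M.rank) ℂ) (V : Matrix (Fin M.rank) (Fin n) ℂ), M = U * V := by
  obtain ⟨u, v, c, -, -, -, h⟩ :=
    (hasSchmidtDecomposition_iff (fun p : Fin m × Fin n => M p.1 p.2) M.rank).2 rfl
  refine ⟨Matrix.of fun a i => u i a, Matrix.of fun i b => c i * v i b, ?_⟩
  ext a b
  refine (h a b).trans ?_
  rw [mul_apply]
  exact Finset.sum_congr rfl fun i _ => by simp only [of_apply]; ring

theorem exists_eq_vecMulVec_of_rank_le_one {M : Matrix (Fin m) (Fin n) ℂ} (h : M.rank ≤ 1) :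
    ∃ (a : Fin m → ℂ) (b : Fin n → ℂ), M = vecMulVec a b := by
  obtain ⟨U, V, hUV⟩ := exists_eq_mul_rank M
  generalize M.rank = r at U V hUV h
  interval_cases r
  · exact ⟨0, 0, by rw [hUV]; ext a b; simp [mul_apply, vecMulVec_apply]⟩
  · exact ⟨fun a => U a 0, fun b => V 0 b, by rw [hUV]; ext a b; simp [mul_apply, vecMulVec_apply]⟩

theorem outer_vecMulVec (a : Fin m → ℂ) (b : Fin n → ℂ) :
    outer (vecMulVec a b) = vecMulVec a (star a) ⊗ₖ vecMulVec b (star b) := by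
  ext p q
  simp only [outer, vecMulVec_apply, Pi.star_apply, star_mul', kroneckerMap_apply]
  ring

/-- Rank at most one means `M = vecMulVec a b`, whose `outer` is a Kronecker product of two rank-one
positive matrices; conversely, both factors of `A ⊗ₖ B` split into such matrices. -/
theorem isSeparable_iff {X : Matrix (Fin m × Fin n) (Fin m × Fin n) ℂ} :
    IsSeparable X ↔ X ∈ schmidtCone m n 1 := by
  constructor
  · rintro ⟨N, A, B, hA, hB, rfl⟩
    refine sum_mem fun i _ => ?_
    obtain ⟨S, hS⟩ := exists_eq_mul_conjTranspose (hA i)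
    obtain ⟨T, hT⟩ := exists_eq_mul_conjTranspose (hB i)
    have : A i ⊗ₖ B i = ∑ j, ∑ l, outer (vecMulVec (S.col j) (T.col l)) := by
      rw [hS, hT, mul_conjTranspose_eq_sum, mul_conjTranspose_eq_sum]
      ext p q
      simp only [outer_vecMulVec, kroneckerMap_apply, Matrix.sum_apply, Finset.sum_mul_sum]
    rw [this]
    exact sum_mem fun j _ => sum_mem fun l _ => outer_mem_schmidtCone (rank_vecMulVec_le _ _)
  · intro h
    obtain ⟨N, M, hM, rfl⟩ := exists_sum_of_mem_schmidtCone h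
    choose a b hab using fun i => exists_eq_vecMulVec_of_rank_le_one (hM i)
    refine ⟨N, _, _, fun i => posSemidef_vecMulVec_self_star (a i),
      fun i => posSemidef_vecMulVec_self_star (b i), Finset.sum_congr rfl fun i _ => ?_⟩
    rw [← outer_vecMulVec, ← hab]

end schmidtNumber

/-! ### Comparing two Gram factorizations. -/

section lift

theorem mul_eq_zero_of_mul_mul_conjTranspose_eq_zero {ι κ : Type*} [Fintype ι] [Fintype κ]
    {A : Matrix ι ι ℂ} {E : Matrix ι κ ℂ}
    (h : A * (E * Eᴴ) = 0) : A * E = 0 := by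
  rw [← self_mul_conjTranspose_eq_zero (A := A * E), conjTranspose_mul,
    show A * E * (Eᴴ * Aᴴ) = A * (E * Eᴴ) * Aᴴ by simp only [Matrix.mul_assoc], h, Matrix.zero_mul]

variable {ι κ : Type*} [Fintype ι] [DecidableEq ι] [Fintype κ]

theorem _root_.Matrix.IsHermitian.exists_isHermitian_mul_mul_eq {H : Matrix ι ι ℂ}
    (hH : H.IsHermitian) : ∃ P : Matrix ι ι ℂ, P.IsHermitian ∧ H * P * H = H := by
  have hsa : IsSelfAdjoint H := hH
  have hc : ∀ f : ℝ → ℝ, ContinuousOn f (spectrum ℝ H) := fun f =>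
    (finite_real_spectrum (A := H)).continuousOn f
  -- The pseudo-inverse: with `0⁻¹ = 0`, the identity `x * x⁻¹ * x = x` holds at 0 too, and any
  -- function is continuous on a finite spectrum.
  refine ⟨cfc (fun x : ℝ => x⁻¹) H, IsSelfAdjoint.cfc, ?_⟩
  nth_rewrite 1 [← cfc_id' ℝ H]
  nth_rewrite 3 [← cfc_id' ℝ H]
  rw [← cfc_mul _ _ H (hc _) (hc _), ← cfc_mul _ _ H (hc _) (hc _)]
  conv_rhs => rw [← cfc_id' ℝ H]
  exact cfc_congr fun x _ => by simp

/-- Two Gram factorizations of a matrix are related by a coisometry, up to the kernel. -/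
theorem exists_mul_eq_of_mul_conjTranspose_eq {μ : Type*} [Fintype μ] [DecidableEq κ]
    {T : Matrix κ ι ℂ} {E : Matrix κ μ ℂ} (h : T * Tᴴ = E * Eᴴ) :
    ∃ (W : Matrix ι μ ℂ) (R : Matrix ι ι ℂ), T * W = E ∧ T * R = 0 ∧ W * Wᴴ + R * Rᴴ = 1 := by
  obtain ⟨P, hP, hHP⟩ := (isHermitian_mul_conjTranspose_self T).exists_isHermitian_mul_mul_eq
  have h0 : (T * Tᴴ * P - 1) * (T * Tᴴ) = 0 := by rw [Matrix.sub_mul, hHP, Matrix.one_mul, sub_self]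
  have hT : T * Tᴴ * P * T = T := by
    have := mul_eq_zero_of_mul_mul_conjTranspose_eq_zero h0
    rwa [Matrix.sub_mul, Matrix.one_mul, sub_eq_zero] at this
  have hE : T * Tᴴ * P * E = E := by
    have := mul_eq_zero_of_mul_mul_conjTranspose_eq_zero (h ▸ h0 : (T * Tᴴ * P - 1) * (E * Eᴴ) = 0)
    rwa [Matrix.sub_mul, Matrix.one_mul, sub_eq_zero] at this
  have hPH : Pᴴ = P := hP
  have hQ : Tᴴ * P * T * (Tᴴ * P * T) = Tᴴ * P * T := by
    calc _ = Tᴴ * P * (T * Tᴴ * P * T) := by simp only [Matrix.mul_assoc]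
      _ = _ := by rw [hT]
  -- With `P` the pseudo-inverse of `T * Tᴴ`, `Tᴴ * P * T` is the projection onto the range of `Tᴴ`
  -- and equals `W * Wᴴ`; `R` is the complementary projection, onto the kernel of `T`.
  refine ⟨Tᴴ * P * E, 1 - Tᴴ * P * T, ?_, ?_, ?_⟩
  · simpa only [Matrix.mul_assoc] using hE
  · rw [Matrix.mul_sub, Matrix.mul_one, sub_eq_zero]
    simpa only [Matrix.mul_assoc] using hT.symm
  · have h1 : Tᴴ * P * E * (Tᴴ * P * E)ᴴ = Tᴴ * P * T := by
      rw [conjTranspose_mul, conjTranspose_mul, conjTranspose_conjTranspose, hPH]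
      calc _ = Tᴴ * P * (E * Eᴴ) * (P * T) := by simp only [Matrix.mul_assoc]
        _ = Tᴴ * P * (T * Tᴴ * P * T) := by rw [← h]; simp only [Matrix.mul_assoc]
        _ = _ := by rw [hT]
    have h2 : (1 - Tᴴ * P * T)ᴴ = 1 - Tᴴ * P * T := by
      simp only [conjTranspose_sub, conjTranspose_one, conjTranspose_mul,
        conjTranspose_conjTranspose, hPH, Matrix.mul_assoc]
    rw [h1, h2, Matrix.mul_sub, Matrix.sub_mul, Matrix.sub_mul, hQ]
    simp

end lift

/-! ### Compressing the first factor, and the drop in Schmidt number. -/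

variable {m n k l s : ℕ}

/-- A decomposition of a compression of `Y` lifts to a decomposition of `Y`. -/
theorem mem_closure_of_submatrix_mem_schmidtCone (g : Fin l → Fin k)
    {Y : Matrix (Fin k × Fin n) (Fin k × Fin n) ℂ} (hY : Y.PosSemidef)
    (h : Y.submatrix (Prod.map g id) (Prod.map g id) ∈ schmidtCone l n s) :
    Y ∈ AddSubmonoid.closure {X | ∃ M : Matrix (Fin k) (Fin n) ℂ,
      (M.submatrix g id).rank ≤ s ∧ X = outer M} := by
  obtain ⟨S, rfl⟩ := exists_eq_mul_conjTranspose hY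
  obtain ⟨N, M, hM, hsum⟩ := exists_sum_of_mem_schmidtCone h
  set T : Matrix (Fin l × Fin n) (Fin k × Fin n) ℂ := S.submatrix (Prod.map g id) id with hT
  let E : Matrix (Fin l × Fin n) (Fin N) ℂ := Matrix.of fun p i => M i p.1 p.2
  have hTE : T * Tᴴ = E * Eᴴ := by
    rw [mul_conjTranspose_eq_sum E]
    exact hsum
  obtain ⟨W, R, hW, hR, hWR⟩ := exists_mul_eq_of_mul_conjTranspose_eq hTE
  have key : S * Sᴴ = (S * W) * (S * W)ᴴ + (S * R) * (S * R)ᴴ := by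
    calc S * Sᴴ = S * (W * Wᴴ + R * Rᴴ) * Sᴴ := by rw [hWR, Matrix.mul_one]
      _ = _ := by simp only [conjTranspose_mul, Matrix.mul_add, Matrix.add_mul, Matrix.mul_assoc]
  rw [key, mul_conjTranspose_eq_sum, mul_conjTranspose_eq_sum]
  -- Restricted to the rows chosen by `g`, the columns of `S * W` become those of `E`, that is the
  -- `M j`, and the columns of `S * R` vanish.
  refine add_mem (sum_mem fun j _ => AddSubmonoid.subset_closure ⟨_, ?_, vecMulVec_eq_outer _⟩)
    (sum_mem fun j _ => AddSubmonoid.subset_closure ⟨_, ?_, vecMulVec_eq_outer _⟩)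
  · convert hM j
    ext a b
    exact congr_fun (congr_fun hW (a, b)) j
  · convert Nat.zero_le s
    rw [← rank_zero (R := ℂ) (m := Fin l) (n := Fin n)]
    congr 1
    ext a b
    exact congr_fun (congr_fun hR (a, b)) j

theorem _root_.Matrix.rank_add_le {α β : Type*} [Fintype α] [Fintype β] (A B : Matrix α β ℂ) :
    (A + B).rank ≤ A.rank + B.rank := by
  rw [Matrix.rank, mulVecLin_add]
  refine le_trans (Submodule.finrank_mono ?_) (Submodule.finrank_add_le_finrank_add_finrank _ _)
  rintro _ ⟨x, rfl⟩
  exact Submodule.add_mem_sup (LinearMap.mem_range_self _ x) (LinearMap.mem_range_self _ x)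

theorem rank_le_rank_submatrix_add {g : Fin l → Fin k} (hg : g.Injective)
    (M : Matrix (Fin k) (Fin n) ℂ) : M.rank ≤ (M.submatrix g id).rank + (k - l) := by
  classical
  -- `G` puts the selected rows back in place, so `B` lives on the other `k - l` rows.
  let G : Matrix (Fin k) (Fin l) ℂ := Matrix.of fun a i => if a = g i then 1 else 0
  let B : Matrix (Fin k) (Fin n) ℂ := M - G * M.submatrix g id
  have hB : ∀ i, B (g i) = 0 := by
    intro i
    ext b
    simp [B, G, mul_apply, hg.eq_iff]
  have hBr : B.rank ≤ k - l := by
    refine (rank_le_card_of_support_subset B (Finset.univ.image g)ᶜ ?_).trans ?_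
    · intro a ha
      simp only [Finset.coe_compl, Finset.coe_image, Finset.coe_univ, Set.image_univ,
        Set.mem_compl_iff, Set.mem_range, not_exists]
      rintro i rfl
      exact ha (hB i)
    · rw [Finset.card_compl, Finset.card_image_of_injective _ hg]
      simp
  calc M.rank = (G * M.submatrix g id + B).rank := by simp [B]
    _ ≤ _ := rank_add_le _ _
    _ ≤ _ := add_le_add (rank_mul_le_right _ _) hBr

/-- If the compression to two levels of the first factor is separable, the Schmidt number is
not maximal. -/
theorem mem_schmidtCone_of_submatrix_mem {g : Fin l → Fin k} (hg : g.Injective)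
    {Y : Matrix (Fin k × Fin n) (Fin k × Fin n) ℂ} (hY : Y.PosSemidef)
    (h : Y.submatrix (Prod.map g id) (Prod.map g id) ∈ schmidtCone l n s) :
    Y ∈ schmidtCone k n (s + (k - l)) := by
  refine AddSubmonoid.closure_mono ?_ (mem_closure_of_submatrix_mem_schmidtCone g hY h)
  rintro _ ⟨M, hM, rfl⟩
  exact ⟨M, (rank_le_rank_submatrix_add hg M).trans (Nat.add_le_add_right hM _), rfl⟩

theorem link_mem_schmidtCone_pred {C : Matrix (Fin m × Fin n) (Fin m × Fin n) ℂ}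
    (hC : C.PosSemidef) (h2 : ∀ X : Matrix (Fin 2 × Fin m) (Fin 2 × Fin m) ℂ, X.PosSemidef →
      link X C ∈ schmidtCone 2 n 1) (hs : 2 ≤ s)
    {X : Matrix (Fin k × Fin m) (Fin k × Fin m) ℂ} (hX : X ∈ schmidtCone k m s) :
    link X C ∈ schmidtCone k n (s - 1) := by
  induction hX using AddSubmonoid.closure_induction with
  | zero => rw [link_zero_left]; exact zero_mem _
  | add X Y _ _ hX hY => rw [link_add_left]; exact add_mem hX hY
  | mem X hX =>
    obtain ⟨M, hM, rfl⟩ := hX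
    obtain hr | hr := Nat.lt_or_ge M.rank 2
    -- Here the rank is at most `1 ≤ s - 1` already.
    · exact link_mem_schmidtCone_left (outer_mem_schmidtCone (by omega)) hC
    · obtain ⟨U, V, hUV⟩ := exists_eq_mul_rank M
      rw [hUV, ← link_outer_outer, link_assoc]
      refine link_mem_schmidtCone_right (posSemidef_outer U) ?_
      -- Any two rows serve for the compression; the first two are kept.
      have hY : link (outer V) C ∈ schmidtCone M.rank n (1 + (M.rank - 2)) :=
        mem_schmidtCone_of_submatrix_mem (Fin.castLE_injective hr)
          (link_posSemidef (posSemidef_outer V) hC) (by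
            rw [link_submatrix, outer_submatrix]
            exact h2 _ (posSemidef_outer _))
      exact schmidtCone_mono (by omega) hY

/-! ### Translation to linear maps through the Choi matrix. -/

section maps

variable {d₁ d₂ : ℕ}

theorem ampliation_eq_link (Φ : Matrix (Fin d₁) (Fin d₁) ℂ →ₗ[ℂ] Matrix (Fin d₂) (Fin d₂) ℂ)
    (X : Matrix (Fin k × Fin d₁) (Fin k × Fin d₁) ℂ) : ampliation k Φ X = link X (choi Φ) := by
  ext p q
  simp only [ampliation, link, choi, of_apply]
  rw [matrix_eq_sum_single (Matrix.of fun a b => X (p.1, a) (q.1, b))]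
  simp only [map_sum, Matrix.sum_apply, of_apply]
  refine Finset.sum_congr rfl fun i _ => Finset.sum_congr rfl fun j _ => ?_
  rw [← mul_one (X (p.1, i) (q.1, j)), ← smul_eq_mul, ← smul_single, map_smul]
  simp

theorem choi_comp (Φ : Matrix (Fin d₁) (Fin d₁) ℂ →ₗ[ℂ] Matrix (Fin d₂) (Fin d₂) ℂ)
    (Ψ : Matrix (Fin m) (Fin m) ℂ →ₗ[ℂ] Matrix (Fin d₁) (Fin d₁) ℂ) :
    choi (Φ ∘ₗ Ψ) = link (choi Ψ) (choi Φ) := by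
  rw [← ampliation_eq_link]
  rfl

theorem link_outer_one (C : Matrix (Fin m × Fin n) (Fin m × Fin n) ℂ) :
    link (outer 1) C = C := by
  ext p q
  simp [link, outer, vecMulVec_apply, one_apply]

/-- `outer 1` is the unnormalized maximally entangled state; testing on it at level `d₁` returns the
Choi matrix, and `1 ≤ d₁` makes this level admissible. -/
theorem isCP_iff (hd : 1 ≤ d₁)
    {Φ : Matrix (Fin d₁) (Fin d₁) ℂ →ₗ[ℂ] Matrix (Fin d₂) (Fin d₂) ℂ} :
    IsCP Φ ↔ (choi Φ).PosSemidef := by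
  constructor
  · intro h
    have := h d₁ hd (outer 1) (posSemidef_outer 1)
    rwa [ampliation_eq_link, link_outer_one] at this
  · intro h k _ X hX
    rw [ampliation_eq_link]
    exact link_posSemidef hX h

theorem isEB_iff (hd : 1 ≤ d₁)
    {Φ : Matrix (Fin d₁) (Fin d₁) ℂ →ₗ[ℂ] Matrix (Fin d₂) (Fin d₂) ℂ} :
    IsEB Φ ↔ choi Φ ∈ schmidtCone d₁ d₂ 1 := by
  simp only [IsEB, ampliation_eq_link, isSeparable_iff]
  constructor
  · intro h
    have := h d₁ hd (outer 1) (posSemidef_outer 1)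
    rwa [link_outer_one] at this
  · intro h k _ X hX
    exact link_mem_schmidtCone_right hX h

/-- The linear map with a given Choi matrix. -/
def ofChoi (C : Matrix (Fin d₁ × Fin d₂) (Fin d₁ × Fin d₂) ℂ) :
    Matrix (Fin d₁) (Fin d₁) ℂ →ₗ[ℂ] Matrix (Fin d₂) (Fin d₂) ℂ where
  toFun Z := Matrix.of fun a b => ∑ i, ∑ j, Z i j * C (i, a) (j, b)
  map_add' Z W := by
    ext a b
    simp [add_mul, Finset.sum_add_distrib]
  map_smul' c Z := by
    ext a b
    simp [Finset.mul_sum, mul_assoc]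

theorem choi_ofChoi (C : Matrix (Fin d₁ × Fin d₂) (Fin d₁ × Fin d₂) ℂ) :
    choi (ofChoi C) = C := by
  ext p q
  simp only [choi, ofChoi, of_apply, LinearMap.coe_mk, AddHom.coe_mk, single_apply, ite_and,
    ite_mul, one_mul, zero_mul]
  simp

theorem choi_injective : Function.Injective (choi (d₁ := d₁) (d₂ := d₂)) := by
  intro Φ Ψ h
  refine Matrix.ext_linearMap ℂ fun i j => LinearMap.ext_ring ?_
  ext a b
  exact congr_fun (congr_fun h (i, a)) (j, b)

theorem IsCP.isKPEB (hd : 1 ≤ d₁)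
    {Φ : Matrix (Fin d₁) (Fin d₁) ℂ →ₗ[ℂ] Matrix (Fin d₂) (Fin d₂) ℂ} (h : IsCP Φ)
    (hk : d₁ ≤ k) : IsKPEB k Φ := by
  obtain ⟨N, M, -, hM⟩ := exists_sum_of_mem_schmidtCone
    (mem_schmidtCone_of_posSemidef ((isCP_iff hd).1 h) le_rfl)
  -- The convention `Vᴴ * X * V` makes the Kraus operators the entrywise conjugates of the `M i`;
  -- their rank is at most `d₁`.
  refine ⟨h, N, fun i => (M i).map star, fun i => (rank_le_height _).trans hk, fun X => ?_⟩
  obtain rfl : Φ = ofChoi (∑ i, outer (M i)) := choi_injective (by rw [choi_ofChoi, hM])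
  ext a b
  simp only [ofChoi, LinearMap.coe_mk, AddHom.coe_mk, of_apply, Matrix.sum_apply, outer,
    vecMulVec_apply, Pi.star_apply, Finset.mul_sum, mul_apply, conjTranspose_apply, map_apply,
    star_star, Finset.sum_mul]
  rw [Finset.sum_comm]
  simp_rw [Finset.sum_comm (s := (Finset.univ : Finset (Fin d₁))) (t := (Finset.univ : Finset (Fin N)))]
  refine Finset.sum_congr rfl fun i _ => Finset.sum_congr rfl fun j _ =>
    Finset.sum_congr rfl fun l _ => by ring

theorem isKEB_iff
    {Φ : Matrix (Fin d₁) (Fin d₁) ℂ →ₗ[ℂ] Matrix (Fin d₂) (Fin d₂) ℂ} (h : IsCP Φ) (hk : 1 ≤ k) :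
    IsKEB k Φ ↔ ∀ X : Matrix (Fin k × Fin d₁) (Fin k × Fin d₁) ℂ, X.PosSemidef →
      link X (choi Φ) ∈ schmidtCone k d₂ 1 := by
  simp only [IsKEB, ampliation_eq_link, isSeparable_iff]
  exact and_iff_right (h k hk)

theorem IsKEB.SN_comp_lt {Φ : Matrix (Fin d₁) (Fin d₁) ℂ →ₗ[ℂ] Matrix (Fin d₂) (Fin d₂) ℂ}
    (hd : 1 ≤ d₁) (hΦ : IsCP Φ) (h : IsKEB 2 Φ) (hm : 1 ≤ m)
    {Ψ : Matrix (Fin m) (Fin m) ℂ →ₗ[ℂ] Matrix (Fin d₁) (Fin d₁) ℂ}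
    (hΨ : IsCP Ψ) (hΨ' : ¬ IsEB Ψ) : SN (Φ ∘ₗ Ψ) < SN Ψ := by
  have hpos := (isCP_iff hm).1 hΨ
  have h2 : 2 ≤ SN Ψ := by
    by_contra hlt
    exact hΨ' ((isEB_iff hm).2 ((schmidtNumber_le_iff hpos).1 (by rw [← SN]; omega)))
  have h3 : SN (Φ ∘ₗ Ψ) ≤ SN Ψ - 1 := by
    rw [SN, choi_comp]
    exact schmidtNumber_le_of_mem (link_mem_schmidtCone_pred ((isCP_iff hd).1 hΦ)
      ((isKEB_iff hΦ one_le_two).1 h) h2 (mem_schmidtCone_schmidtNumber hpos))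
  omega

theorem isKEB_two_of_SN_comp_lt
    {Φ : Matrix (Fin d₁) (Fin d₁) ℂ →ₗ[ℂ] Matrix (Fin d₂) (Fin d₂) ℂ} (hd : 1 ≤ d₁) (hΦ : IsCP Φ)
    (h : ∀ Ψ : Matrix (Fin 2) (Fin 2) ℂ →ₗ[ℂ] Matrix (Fin d₁) (Fin d₁) ℂ,
      -- Apply the hypothesis to the map with Choi matrix `X`. If it is EB, `X` is already separable
      -- and stays so; otherwise its Schmidt number is at most 2 and drops strictly.
      IsCP Ψ → ¬ IsEB Ψ → SN (Φ ∘ₗ Ψ) < SN Ψ) : IsKEB 2 Φ := by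
  rw [isKEB_iff hΦ one_le_two]
  intro X hX
  have hC := (isCP_iff hd).1 hΦ
  by_cases hEB : IsEB (ofChoi X)
  · rw [isEB_iff one_le_two, choi_ofChoi] at hEB
    exact link_mem_schmidtCone_left hEB hC
  · have h1 := h (ofChoi X) ((isCP_iff one_le_two).2 (by rwa [choi_ofChoi])) hEB
    have h2 : SN (ofChoi X) ≤ 2 := by
      rw [SN, choi_ofChoi]
      exact schmidtNumber_le_of_mem (mem_schmidtCone_of_posSemidef hX le_rfl)
    rw [SN, choi_comp, choi_ofChoi] at h1
    exact (schmidtNumber_le_iff (link_posSemidef hX hC)).1 (by omega)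

end maps

end EntBreak

/-! ### The equivalences. -/

theorem mainTheorem6 (d₁ d₂ : ℕ) (hd₁ : 1 < d₁) (hd₂ : 1 < d₂)
    (Φ : Matrix (Fin d₁) (Fin d₁) ℂ →ₗ[ℂ] Matrix (Fin d₂) (Fin d₂) ℂ)
    (hΦ : EntBreak.IsCP Φ) :
    List.TFAE [
      EntBreak.IsKEB 2 Φ,
      ∀ m : ℕ, 2 ≤ m → m ≤ d₂ →
        ∀ Ψ : Matrix (Fin m) (Fin m) ℂ →ₗ[ℂ] Matrix (Fin d₁) (Fin d₁) ℂ,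
          EntBreak.IsCP Ψ → ¬ EntBreak.IsEB Ψ → EntBreak.SN (Φ ∘ₗ Ψ) < EntBreak.SN Ψ,
      ∀ m : ℕ, 2 ≤ m →
        ∀ Ψ : Matrix (Fin m) (Fin m) ℂ →ₗ[ℂ] Matrix (Fin d₁) (Fin d₁) ℂ,
          EntBreak.IsKPEB d₂ Ψ → ¬ EntBreak.IsEB Ψ → EntBreak.SN (Φ ∘ₗ Ψ) < EntBreak.SN Ψ,
      ∀ Ψ : Matrix (Fin 2) (Fin 2) ℂ →ₗ[ℂ] Matrix (Fin d₁) (Fin d₁) ℂ,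
        EntBreak.IsCP Ψ → ¬ EntBreak.IsEB Ψ → EntBreak.SN (Φ ∘ₗ Ψ) < EntBreak.SN Ψ] := by
  tfae_have 1 → 2 := fun h m hm _ Ψ hΨ hEB => h.SN_comp_lt hd₁.le hΦ (by omega) hΨ hEB
  tfae_have 1 → 3 := fun h m hm Ψ hΨ hEB => h.SN_comp_lt hd₁.le hΦ (by omega) hΨ.1 hEB
  tfae_have 2 → 4 := fun h => h 2 le_rfl hd₂
  -- Kraus operators of a map on `M_2` have rank at most `2 ≤ d₂`.
  tfae_have 3 → 4 := fun h Ψ hΨ => h 2 le_rfl Ψ (hΨ.isKPEB one_le_two hd₂)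
  tfae_have 4 → 1 := EntBreak.isKEB_two_of_SN_comp_lt hd₁.le hΦ
  tfae_finish
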